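/- Let $q>1$ be an odd integer and let $R$ be an integral domain (a nonzero commutative ring without zero divisors) which is not isomorphic to $\mathbb F_2$ or $\mathbb F_3$. An element $t$ of a ring is called $q$-potent if $t^q=t$, and an element $v$ is called an involution if $v^2=1$. For a positive integer $n$, let $\mathbb M_n(R)$ be the ring of $n\times n$ matrices over $R$. Then the following conditions are equivalent: (1) for every $n\ge 1$, each matrix in $\mathbb M_n(R)$ is a sum of an idempotent matrix and an invertible $q$-potent matrix; (1') for some $n\ge 1$, each matrix in $\mathbb M_n(R)$ is a sum of an idempotent matrix and an invertible $q$-potent matrix; (2) for every $n\ge 1$, each matrix in $\mathbb M_n(R)$ is a sum of an idempotent matrix and a $q$-potent matrix; (2') for some $n\ge 1$, each matrix in $\mathbb M_n(R)$ is a sum of an idempotent matrix and a $q$-potent matrix; (3) $R$ is a finite field and $(|R|-1)\mid (q-1)$. If, in addition, $2$ is a unit of $R$ and $R$ is not isomorphic to $\mathbb F_3$, $\mathbb F_5$ or $\mathbb F_9$, then each of these conditions is also equivalent to each of the following: (4) for every $n\ge 1$, each matrix in $\mathbb M_n(R)$ is a sum of an involution and an invertible $q$-potent matrix; (4') for some $n\ge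 1$, each matrix in $\mathbb M_n(R)$ is a sum of an involution and an invertible $q$-potent matrix. -/

import Mathlib

/-- An element `t` of a ring is `q`-potent if `t ^ q = t`. -/
def IsQPotent {S : Type*} [Ring S] (q : ℕ) (t : S) : Prop :=
  t ^ q = t

/-- An element `v` of a ring is an involution if `v ^ 2 = 1`. -/
def IsInvolution {S : Type*} [Ring S] (v : S) : Prop :=
  v ^ 2 = 1

/-- Every element of `S` is a sum of an idempotent and an invertible `q`-potent. -/
def AllIdempotentAddInvertiblePotent (q : ℕ) (S : Type*) [Ring S] : Prop :=
  ∀ a : S, ∃ e u : S, IsIdempotentElem e ∧ IsUnit u ∧ IsQPotent q u ∧ a = e + u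

/-- Every element of `S` is a sum of an idempotent and a `q`-potent. -/
def AllIdempotentAddPotent (q : ℕ) (S : Type*) [Ring S] : Prop :=
  ∀ a : S, ∃ e f : S, IsIdempotentElem e ∧ IsQPotent q f ∧ a = e + f

/-- Every element of `S` is a sum of an involution and an invertible `q`-potent. -/
def AllInvolutionAddInvertiblePotent (q : ℕ) (S : Type*) [Ring S] : Prop :=
  ∀ a : S, ∃ v u : S, IsInvolution v ∧ IsUnit u ∧ IsQPotent q u ∧ a = v + u

/-! Necessity comes from scalar matrices. If `a • 1 = e + f`, then `f` acts on `1` as `a` (when `e =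
0`) or on `e` as `a - 1`, so one of these scalars is `q`-potent. Since `X ^ q - X` has finitely many
roots, `R` is a finite field. A translation argument on the group of `q`-potent units (a counting
argument for involutions) shows that every unit is `q`-potent, and cyclicity of the unit group gives
the divisibility.

For sufficiency, split the space into cyclic modules `K[X] ⧸ (g)`. In a Newton basis, multiplication
by `X` is bidiagonal outside its last column, with a prescribed diagonal whose last entry is forced
by the trace. Basis vectors alternate between two classes, `W` (which contains the last one) and
`U`. An idempotent `E` absorbs the subdiagonal entries leading from `U` to `W`. What remains, `D = A
- E`, satisfies `(D² - α²)(D² - β²) = 0`: `(D + α)(D - β)` maps everything into the span of `U`, and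
`(D - α)(D + β)` kills that span. As `α² ≠ β²`, this forces `D ^ (q - 1) = 1`. Four elements in `K`
suffice to choose `α` and `β` compatibly with the trace. -/

/-- A scalar by which a `q`-potent element acts on a nonzero element is itself `q`-potent. -/
theorem IsQPotent.eigenvalue {R S : Type*} [CommRing R] [IsDomain R] [Ring S] [Algebra R S]
    [Module.IsTorsionFree R S] {q : ℕ} {u w : S} {c : R} (hu : IsQPotent q u) (hw : w ≠ 0)
    (h : u * w = c • w) : c ^ q = c := by
  have key : ∀ k : ℕ, u ^ k * w = c ^ k • w := by
    intro k
    induction k with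
    | zero => simp
    | succ k ih => rw [pow_succ, mul_assoc, h, mul_smul_comm, ih, smul_smul, pow_succ, mul_comm]
  have h2 := key q
  rw [hu, h] at h2
  exact (smul_left_injective R hw h2).symm

theorem AllIdempotentAddPotent.scalar {R S : Type*} [CommRing R] [IsDomain R] [Ring S]
    [Nontrivial S] [Algebra R S] [Module.IsTorsionFree R S] {q : ℕ}
    (h : AllIdempotentAddPotent q S) (a : R) : a ^ q = a ∨ (a - 1) ^ q = a - 1 := by
  obtain ⟨e, f, he, hf, hef⟩ := h (algebraMap R S a)
  rw [Algebra.algebraMap_eq_smul_one] at hef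
  by_cases h0 : e = 0
  · left
    refine hf.eigenvalue (w := 1) one_ne_zero ?_
    rw [mul_one, hef, h0, zero_add]
  · right
    refine hf.eigenvalue (w := e) h0 ?_
    rw [← sub_eq_of_eq_add' hef, sub_mul, he.eq, sub_smul, one_smul, smul_mul_assoc, one_mul]

theorem AllInvolutionAddInvertiblePotent.scalar {R S : Type*} [CommRing R] [IsDomain R] [Ring S]
    [Nontrivial S] [Algebra R S] [Module.IsTorsionFree R S] {q : ℕ}
    (h : AllInvolutionAddInvertiblePotent q S) (a : R) :
    (a + 1 ≠ 0 ∧ (a + 1) ^ q = a + 1) ∨ (a - 1 ≠ 0 ∧ (a - 1) ^ q = a - 1) := by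
  obtain ⟨v, u, hv, hu, huq, hvu⟩ := h (algebraMap R S a)
  rw [Algebra.algebraMap_eq_smul_one] at hvu
  have main : ∀ (w : S) (c : R), w ≠ 0 → u * w = c • w → c ≠ 0 ∧ c ^ q = c := by
    intro w c hw hc
    refine ⟨?_, huq.eigenvalue hw hc⟩
    rintro rfl
    rw [zero_smul] at hc
    exact hw (hu.mul_right_eq_zero.mp hc)
  have hu' : u = a • 1 - v := (sub_eq_of_eq_add' hvu).symm
  by_cases h0 : 1 + v = 0
  · left
    refine main 1 _ one_ne_zero ?_
    rw [hu', ← neg_eq_of_add_eq_zero_right h0, mul_one, add_smul, one_smul, sub_neg_eq_add]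
  · right
    -- `v` fixes `1 + v`, so `u = a - v` acts on it as `a - 1`.
    refine main (1 + v) _ h0 ?_
    have hv' : v * v = 1 := by rw [← sq]; exact hv
    have h1 : v * (1 + v) = 1 + v := by rw [mul_add, hv', mul_one, add_comm]
    rw [hu', sub_mul, smul_mul_assoc, one_mul, h1, sub_smul, one_smul]

theorem finite_setOf_pow_eq_self {R : Type*} [CommRing R] [IsDomain R] {q : ℕ} (hq : 1 < q) :
    {a : R | a ^ q = a}.Finite := by
  have h0 : (Polynomial.X ^ q - Polynomial.X : Polynomial R) ≠ 0 := by
    intro h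
    have h1 := congrArg (fun p => Polynomial.coeff p q) h
    simp [Polynomial.coeff_X, hq.ne] at h1
  refine (Polynomial.finite_setOfPred_isRoot h0).subset fun a ha => ?_
  simpa [sub_eq_zero] using ha

/-! ### Potent units of a finite field -/

/-- In a finite field, if every nonzero element is `q`-potent, then `|K| - 1` divides `q - 1`. -/
theorem card_sub_one_dvd_of_forall_pow {K : Type*} [Field K] [Finite K] {q : ℕ} (hq : 1 < q)
    (h : ∀ x : K, x ≠ 0 → x ^ q = x) : Nat.card K - 1 ∣ q - 1 := by
  rw [← Nat.card_units]
  obtain ⟨g, hg⟩ := IsCyclic.exists_generator (α := Kˣ)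
  rw [← orderOf_eq_card_of_forall_mem_zpowers hg]
  refine orderOf_dvd_of_pow_eq_one ?_
  have := h g g.ne_zero
  apply mul_left_cancel (a := g)
  rw [← pow_succ', Nat.sub_add_cancel hq.le, mul_one]
  exact Units.ext (by simpa using this)

/-- The units of `K` which are `q`-potent. -/
def potentUnits (K : Type*) [Field K] (q : ℕ) : Subgroup Kˣ :=
  (powMonoidHom (q - 1) : Kˣ →* Kˣ).ker

theorem mem_potentUnits {K : Type*} [Field K] {q : ℕ} (hq : 1 < q) {u : Kˣ} :
    u ∈ potentUnits K q ↔ (u : K) ^ q = u := by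
  obtain ⟨k, rfl⟩ : ∃ k, q = k + 1 := ⟨q - 1, by omega⟩
  rw [potentUnits, MonoidHom.mem_ker, powMonoidHom_apply, Nat.add_sub_cancel, Units.ext_iff,
    Units.val_pow_eq_pow_val, Units.val_one, pow_succ]
  exact ⟨fun h => by rw [h, one_mul], fun h => mul_right_cancel₀ u.ne_zero (by rw [h, one_mul])⟩

/-- The order of `T` divides `|K| - 1`, which is `-1` in `K`. -/
theorem natCast_card_subgroup_units_ne_zero {K : Type*} [Field K] [Finite K] (T : Subgroup Kˣ) :
    (Nat.card T : K) ≠ 0 := by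
  intro h
  obtain ⟨k, hk⟩ := T.card_subgroup_dvd_card
  have h1 : Nat.card K = Nat.card T * k + 1 := by
    rw [← hk, Nat.card_units]
    have := Nat.card_pos (α := K)
    omega
  have h2 : (Nat.card K : K) = 0 := by
    have := Fintype.ofFinite K
    rw [Nat.card_eq_fintype_card]
    exact FiniteField.cast_card_eq_zero K
  rw [h1] at h2
  push_cast at h2
  rw [h, zero_mul, zero_add] at h2
  exact one_ne_zero h2

/-- If `x` is not `q`-potent, translation by `x` permutes the group `T` of `q`-potent units. Summing
over `T` gives `|T| x = 0`, so `x = 0`, which is absurd. -/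
theorem forall_pow_eq_self_of_or_sub_one {K : Type*} [Field K] [Finite K] {q : ℕ} (hq : 1 < q)
    (hodd : Odd q) (h : ∀ a : K, a ^ q = a ∨ (a - 1) ^ q = a - 1) (x : K) : x ^ q = x := by
  by_contra hx
  have hstep : ∀ t : Kˣ, t ∈ potentUnits K q → ∃ s : potentUnits K q, ((s : Kˣ) : K) = x + t := by
    intro t ht
    rw [mem_potentUnits hq] at ht
    have hne : x + t ≠ 0 := by
      intro h0
      apply hx
      rw [eq_neg_of_add_eq_zero_left h0, hodd.neg_pow, ht]
    refine ⟨⟨Units.mk0 _ hne, (mem_potentUnits hq).mpr ?_⟩, rfl⟩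
    rw [Units.val_mk0]
    have e1 : x + t = (-x / t - 1) * -t := by field_simp; ring
    have hn : (-(t : K)) ^ q = -t := by rw [hodd.neg_pow, ht]
    rcases h (-x / t) with h1 | h1
    · exfalso
      apply hx
      have e2 : x = (-x / t) * -t := by field_simp
      rw [e2, mul_pow, h1, hn]
    · rw [e1, mul_pow, h1, hn]
  choose f hf using fun t : potentUnits K q => hstep t t.2
  have hinj : Function.Injective f := by
    intro s t hst
    have h1 := hf s
    rw [hst, hf t] at h1
    exact Subtype.ext (Units.ext (add_left_cancel h1)).symm
  have hbij : Function.Bijective f := Finite.injective_iff_bijective.mp hinj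
  have := Fintype.ofFinite (potentUnits K q)
  have hsum : ∑ t : potentUnits K q, ((f t : Kˣ) : K) = ∑ t : potentUnits K q, ((t : Kˣ) : K) :=
    hbij.sum_comp fun t : potentUnits K q => ((t : Kˣ) : K)
  simp only [hf, Finset.sum_add_distrib, Finset.sum_const, add_eq_right, nsmul_eq_mul,
    mul_eq_zero, Finset.card_univ, ← Nat.card_eq_fintype_card] at hsum
  rcases hsum with h0 | rfl
  · exact natCast_card_subgroup_units_ne_zero _ h0
  · exact hx (zero_pow (by omega))

/-- Two translates of the group `T` cover `K`, so `|K| ≤ 2 |T|`; a proper subgroup has `2 |T| ≤ |K|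
- 1`. -/
theorem forall_pow_eq_self_of_or_add_one {K : Type*} [Field K] [Finite K] {q : ℕ} (hq : 1 < q)
    (h : ∀ a : K, (a + 1 ≠ 0 ∧ (a + 1) ^ q = a + 1) ∨ (a - 1 ≠ 0 ∧ (a - 1) ^ q = a - 1)) (x : K)
    (hx : x ≠ 0) : x ^ q = x := by
  have htop : potentUnits K q = ⊤ := by
    have hsurj : Function.Surjective (fun t : potentUnits K q ⊕ potentUnits K q =>
        Sum.elim (fun s : potentUnits K q => ((s : Kˣ) : K) - 1)
          (fun s : potentUnits K q => ((s : Kˣ) : K) + 1) t) := by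
      intro a
      rcases h a with ⟨h0, h1⟩ | ⟨h0, h1⟩
      · exact ⟨Sum.inl ⟨Units.mk0 _ h0, (mem_potentUnits hq).mpr h1⟩, by simp⟩
      · exact ⟨Sum.inr ⟨Units.mk0 _ h0, (mem_potentUnits hq).mpr h1⟩, by simp⟩
    have hle := Nat.card_le_card_of_surjective _ hsurj
    rw [Nat.card_sum] at hle
    have hmul := (potentUnits K q).card_mul_index
    rw [Nat.card_units] at hmul
    have hT : 0 < Nat.card (potentUnits K q) := Nat.card_pos
    have hK : 0 < Nat.card K := Nat.card_pos
    have hi : (potentUnits K q).index ≠ 0 := Subgroup.index_ne_zero_of_finite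
    by_contra hne
    have hi1 : (potentUnits K q).index ≠ 1 := fun h1 => hne (Subgroup.index_eq_one.mp h1)
    have : Nat.card (potentUnits K q) * 2 ≤ Nat.card (potentUnits K q) * (potentUnits K q).index :=
      Nat.mul_le_mul_left _ (by omega)
    omega
  have : Units.mk0 x hx ∈ potentUnits K q := htop ▸ Subgroup.mem_top _
  simpa using (mem_potentUnits hq).mp this

/-! ### Necessity, and passage to involutions -/

theorem AllIdempotentAddPotent.finite_field {R S : Type*} [CommRing R] [IsDomain R] [Ring S]
    [Nontrivial S] [Algebra R S] [Module.IsTorsionFree R S] {q : ℕ} (hq : 1 < q) (hodd : Odd q)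
    (h : AllIdempotentAddPotent q S) : Finite R ∧ IsField R ∧ Nat.card R - 1 ∣ q - 1 := by
  have hfin : Finite R := by
    have h1 := finite_setOf_pow_eq_self (R := R) hq
    refine Set.finite_univ_iff.mp ((h1.union (h1.image (· + 1))).subset fun a _ => ?_)
    exact (h.scalar a).imp id fun h2 => ⟨a - 1, h2, sub_add_cancel _ _⟩
  have hfield := Finite.isField_of_domain R
  let := hfield.toField
  exact ⟨hfin, hfield, card_sub_one_dvd_of_forall_pow hq fun x _ =>
    forall_pow_eq_self_of_or_sub_one hq hodd h.scalar x⟩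

theorem AllInvolutionAddInvertiblePotent.finite_field {R S : Type*} [CommRing R] [IsDomain R]
    [Ring S] [Nontrivial S] [Algebra R S] [Module.IsTorsionFree R S] {q : ℕ} (hq : 1 < q)
    (h : AllInvolutionAddInvertiblePotent q S) :
    Finite R ∧ IsField R ∧ Nat.card R - 1 ∣ q - 1 := by
  have hfin : Finite R := by
    have h1 := finite_setOf_pow_eq_self (R := R) hq
    refine Set.finite_univ_iff.mp (((h1.image (· - 1)).union (h1.image (· + 1))).subset
      fun a _ => ?_)
    exact (h.scalar a).imp (fun h2 => ⟨a + 1, h2.2, add_sub_cancel_right _ _⟩)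
      fun h2 => ⟨a - 1, h2.2, sub_add_cancel _ _⟩
  have hfield := Finite.isField_of_domain R
  let := hfield.toField
  exact ⟨hfin, hfield, card_sub_one_dvd_of_forall_pow hq fun x hx =>
    forall_pow_eq_self_of_or_add_one hq h.scalar x hx⟩

/-- Splitting `(a + 1) / 2 = e + u` gives `a = (2e - 1) + 2u`, and `2` is itself `q`-potent. -/
theorem AllIdempotentAddInvertiblePotent.allInvolution {R S : Type*} [Field R] [Finite R] [Ring S]
    [Algebra R S] {q : ℕ} (hq : 1 < q) (h2 : (2 : R) ≠ 0) (hdvd : Nat.card R - 1 ∣ q - 1)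
    (h : AllIdempotentAddInvertiblePotent q S) : AllInvolutionAddInvertiblePotent q S := by
  intro a
  obtain ⟨e, u, he, hu, huq, hsum⟩ := h ((2⁻¹ : R) • (a + 1))
  have h2q : (2 : R) ^ q = 2 := by
    obtain ⟨k, hk⟩ := hdvd
    have hq' : q = (Nat.card R - 1) * k + 1 := by omega
    have := Fintype.ofFinite R
    rw [hq', pow_succ, pow_mul, Nat.card_eq_fintype_card, FiniteField.pow_card_sub_one_eq_one 2 h2,
      one_pow, one_mul]
  refine ⟨(2 : R) • e - 1, (2 : R) • u, ?_, ?_, ?_, ?_⟩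
  · have : (2 : R) • e = e + e := two_smul R e
    rw [IsInvolution, this, sq]
    have he' : e * e = e := he
    simp only [sub_mul, mul_sub, add_mul, mul_add, he', one_mul, mul_one]
    abel
  · exact (hu.smul (Units.mk0 2 h2) :)
  · rw [IsQPotent, smul_pow, h2q, show u ^ q = u from huq]
  · have := congrArg (fun z => (2 : R) • z) hsum
    simp only [smul_smul, smul_add, mul_inv_cancel₀ h2, one_smul] at this
    rw [sub_add_eq_add_sub, ← this, add_sub_cancel_right]

/-! ### Scalars for splitting a cyclic operator -/

open Polynomial in
/-- An element killed by `(X² - α²)(X² - β²)` with distinct squares of `2N`-th roots of unity. -/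
theorem pow_eq_one_of_quartic {K S : Type*} [Field K] [Ring S] [Algebra K S] {D : S} {α β : K}
    {N : ℕ} (hα : (α ^ 2) ^ N = 1) (hβ : (β ^ 2) ^ N = 1) (hne : α ^ 2 ≠ β ^ 2)
    (hD : (D ^ 2 - algebraMap K S (α ^ 2)) * (D ^ 2 - algebraMap K S (β ^ 2)) = 0) :
    D ^ (2 * N) = 1 := by
  have hdvd : (X - C (α ^ 2)) * (X - C (β ^ 2)) ∣ (X ^ N - 1 : K[X]) := by
    refine (isCoprime_X_sub_C_of_isUnit_sub (sub_ne_zero.mpr hne).isUnit).mul_dvd ?_ ?_ <;>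
      rw [dvd_iff_isRoot] <;> simp [hα, hβ]
  obtain ⟨p, hp⟩ := hdvd
  have h := congrArg (aeval (D ^ 2)) hp
  rw [map_mul, map_mul, map_sub, map_sub, map_sub, aeval_X, aeval_C, aeval_C, hD, zero_mul,
    map_pow, map_one, aeval_X, sub_eq_zero] at h
  rw [pow_mul, h]

theorem exists_ne_of_four_le_card {K : Type*} [Finite K] (h4 : 4 ≤ Nat.card K) (x y z : K) :
    ∃ a : K, a ≠ x ∧ a ≠ y ∧ a ≠ z := by
  classical
  have := Fintype.ofFinite K
  rw [Nat.card_eq_fintype_card] at h4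
  obtain ⟨a, ha⟩ : ∃ a, a ∉ ({x, y, z} : Finset K) := by
    by_contra! h
    have h1 : Finset.univ ⊆ ({x, y, z} : Finset K) := fun a _ => h a
    have h2 := (Finset.card_le_card h1).trans Finset.card_le_three
    rw [Finset.card_univ] at h2
    omega
  exact ⟨a, by simpa using ha⟩

theorem exists_add_eq_sq_ne_sq {K : Type*} [Field K] [Finite K] (h4 : 4 ≤ Nat.card K) {s : K}
    (hs : s ≠ 0) : ∃ α β : K, α ≠ 0 ∧ β ≠ 0 ∧ α ^ 2 ≠ β ^ 2 ∧ α + β = s := by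
  obtain ⟨α, h0, h1, h2⟩ := exists_ne_of_four_le_card h4 0 s (s / 2)
  refine ⟨α, s - α, h0, sub_ne_zero.mpr h1.symm, fun h => ?_, add_sub_cancel _ _⟩
  have h3 : s * (2 * α - s) = 0 := by linear_combination h
  have h5 : 2 * α = s := by simpa [hs, sub_eq_zero] using h3
  have h6 : (2 : K) ≠ 0 := by
    intro h6
    rw [h6, zero_mul] at h5
    exact hs h5.symm
  exact h2 (by rw [eq_div_iff h6, mul_comm, h5])

theorem exists_sq_ne_sq {K : Type*} [Field K] [Finite K] (h4 : 4 ≤ Nat.card K) (β : K) :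
    ∃ α : K, α ≠ 0 ∧ α ^ 2 ≠ β ^ 2 := by
  obtain ⟨α, h0, h1, h2⟩ := exists_ne_of_four_le_card h4 0 β (-β)
  exact ⟨α, h0, fun h => (sq_eq_sq_iff_eq_or_eq_neg.mp h).elim h1 h2⟩

theorem sum_range_two_mul_ite {K : Type*} [Field K] (x y : K) (r : ℕ) :
    ∑ k ∈ Finset.range (2 * r), (if Even k then x else y) = r * (x + y) := by
  induction r with
  | zero => simp
  | succ r ih =>
    rw [mul_add, mul_one, Finset.sum_range_succ, Finset.sum_range_succ, ih]
    have h1 : Even (2 * r) := even_two_mul r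
    have h2 : ¬ Even (2 * r + 1) := by simp
    rw [if_pos h1, if_neg h2]
    push_cast
    ring

/-- The scalars used to split a cyclic operator on a space of dimension `m + 1` and trace `t`:
`l k` and `ε k` are the `k`-th diagonal entries of the potent and of the idempotent part. -/
theorem exists_diagonal_splitting {K : Type*} [Field K] [Finite K] (h4 : 4 ≤ Nat.card K) (m : ℕ)
    (t : K) : ∃ (α β εW εU : K) (l : ℕ → K), α ≠ 0 ∧ β ≠ 0 ∧ α ^ 2 ≠ β ^ 2 ∧ εW * εW = εW ∧
      εU * εU = εU ∧ εW + εU = 1 ∧ (∀ k, Even (m + k) → l k = -α) ∧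
      (∀ k, ¬ Even (m + k) → l k = α ∨ l k = -β) ∧
      β + εW + ∑ k ∈ Finset.range m, (l k + if Even (m + k) then εW else εU) = t := by
  obtain ⟨r, rfl | rfl⟩ := Nat.even_or_odd' m
  · have hpar : ∀ k, Even (2 * r + k) ↔ Even k := fun k => by simp [Nat.even_add]
    -- Here the `±α` cancel, so the trace forces `β = t - r - ε`; `ε` in `{0, 1}` is chosen to make
    -- it nonzero.
    obtain ⟨ε, ε', h1, h2, h3, hs⟩ : ∃ ε ε' : K, ε * ε = ε ∧ ε' * ε' = ε' ∧ ε + ε' = 1 ∧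
        t - r - ε ≠ 0 := by
      by_cases h : t - r = 0
      · exact ⟨1, 0, by simp, by simp, by simp, by simp [h]⟩
      · exact ⟨0, 1, by simp, by simp, by simp, by simpa using h⟩
    obtain ⟨α, hα, hne⟩ := exists_sq_ne_sq h4 (t - r - ε)
    refine ⟨α, t - r - ε, ε, ε', fun k => if Even k then -α else α, hα, hs, hne, h1, h2, h3,
      fun k hk => if_pos ((hpar k).mp hk), fun k hk => Or.inl (if_neg fun h => hk ((hpar k).mpr h)),
      ?_⟩
    simp only [hpar]
    rw [Finset.sum_add_distrib, sum_range_two_mul_ite, sum_range_two_mul_ite]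
    linear_combination (r : K) * h3
  · have hpar : ∀ k, Even (2 * r + 1 + k) ↔ ¬ Even k := fun k => by
      simp [Nat.even_add]
    -- One `α` survives cancellation, so the trace asks for `α + β = t - r - 1`. If this is `0`, the
    -- squares would coincide; replacing one `α` by `-β` cancels everything instead.
    by_cases hs : t - r - 1 = 0
    · obtain ⟨β, hβ, hne⟩ := exists_sq_ne_sq h4 (1 : K)
      refine ⟨1, β, 0, 1, fun k => if k = 0 then -β else if Even k then 1 else -1, one_ne_zero, hβ,
        hne.symm, by simp, by simp, by simp, fun k hk => ?_, fun k hk => ?_, ?_⟩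
      · rw [hpar] at hk
        have h0 : k ≠ 0 := by rintro rfl; simp at hk
        simp [h0, hk]
      · rw [hpar, not_not] at hk
        by_cases h0 : k = 0 <;> simp [h0, hk]
      · simp only [hpar, ite_not]
        rw [Finset.sum_range_succ']
        simp only [Nat.even_add_one, ite_not, Nat.succ_ne_zero, if_false, if_true,
          show Even 0 from Even.zero]
        rw [Finset.sum_add_distrib, sum_range_two_mul_ite, sum_range_two_mul_ite]
        linear_combination -hs
    · obtain ⟨α, β, hα, hβ, hne, hsum⟩ := exists_add_eq_sq_ne_sq h4 hs
      refine ⟨α, β, 0, 1, fun k => if Even k then α else -α, hα, hβ, hne, by simp, by simp,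
        by simp, fun k hk => if_neg ((hpar k).mp hk), fun k hk => Or.inl (if_pos ?_), ?_⟩
      · rwa [hpar, not_not] at hk
      · simp only [hpar, ite_not]
        rw [Finset.sum_range_succ, Finset.sum_add_distrib, sum_range_two_mul_ite,
          sum_range_two_mul_ite, if_pos (even_two_mul r), if_pos (even_two_mul r)]
        linear_combination hsum

/-! ### Splitting in an adapted basis -/

/-- `a` is the sum of an idempotent and an element of order dividing `N`. -/
def IsIdempotentAddPeriodic {S : Type*} [Ring S] (N : ℕ) (a : S) : Prop :=
  ∃ e u : S, e * e = e ∧ u ^ N = 1 ∧ a = e + u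

theorem IsIdempotentAddPeriodic.map {S T : Type*} [Ring S] [Ring T] (f : S →+* T) {N : ℕ} {a : S}
    (h : IsIdempotentAddPeriodic N a) : IsIdempotentAddPeriodic N (f a) := by
  obtain ⟨e, u, he, hu, rfl⟩ := h
  exact ⟨f e, f u, by rw [← map_mul, he], by rw [← map_pow, hu, map_one], map_add _ _ _⟩

/-- An operator which is bidiagonal except for its last column splits, given scalars as in
`exists_diagonal_splitting`. -/
theorem exists_splitting_of_basis {K V : Type*} [Field K] [AddCommGroup V] [Module K V] {m : ℕ}
    (v : Module.Basis (Fin (m + 1)) K V) (A : Module.End K V) {α β εW εU : K} {l : ℕ → K}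
    (hW : εW * εW = εW) (hU : εU * εU = εU) (hWU : εW + εU = 1)
    (hlW : ∀ k, Even (m + k) → l k = -α) (hlU : ∀ k, ¬ Even (m + k) → l k = α ∨ l k = -β)
    (hA : ∀ k : Fin m, A (v k.castSucc) =
      (l k + if Even (m + k) then εW else εU) • v k.castSucc + v k.succ)
    (ht : β + εW + ∑ k ∈ Finset.range m, (l k + if Even (m + k) then εW else εU) =
      LinearMap.trace K V A) :
    ∃ E D : Module.End K V, E * E = E ∧ A = E + D ∧
      (D ^ 2 - algebraMap K _ (α ^ 2)) * (D ^ 2 - algebraMap K _ (β ^ 2)) = 0 := by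
  classical
  -- The last column is arbitrary, but the trace determines its diagonal entry.
  have hlast : v.repr (A (v (Fin.last m))) (Fin.last m) = β + εW := by
    rw [LinearMap.trace_eq_matrix_trace K v, Matrix.trace, Fin.sum_univ_castSucc] at ht
    simp only [Matrix.diag_apply, LinearMap.toMatrix_apply, hA, map_add, map_smul,
      Module.Basis.repr_self, Finsupp.add_apply, Finsupp.smul_apply, Finsupp.single_eq_same,
      smul_eq_mul, mul_one] at ht
    have h0 : ∀ k : Fin m, (Finsupp.single k.succ (1 : K)) k.castSucc = 0 := fun k =>
      Finsupp.single_eq_of_ne (Fin.castSucc_lt_succ).ne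
    simp only [h0, add_zero] at ht
    rw [Finset.sum_range, add_comm] at ht
    exact (add_left_cancel ht).symm
  set U : Submodule K V := Submodule.span K {x | ∃ k : Fin (m + 1), ¬ Even (m + k) ∧ v k = x}
    with hUdef
  have hvU : ∀ k : Fin (m + 1), ¬ Even (m + k) → v k ∈ U := fun k hk =>
    Submodule.subset_span ⟨k, hk, rfl⟩
  have hsucc : ∀ k : Fin m, Even (m + (k.succ : Fin (m + 1))) ↔
      ¬ Even (m + (k.castSucc : Fin (m + 1))) := fun k => by
    rw [Fin.val_succ, Fin.val_castSucc, ← add_assoc, Nat.even_add_one]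
  have hlastW : Even (m + (Fin.last m : Fin (m + 1))) := by simp
  -- `E` is idempotent because `εU` and `εW` are, and because `εU + εW = 1` reproduces the
  -- off-diagonal term `v k.succ`.
  let E : Module.End K V := v.constr K (Fin.lastCases (εW • v (Fin.last m)) fun k =>
    if Even (m + k) then εW • v k.castSucc else εU • v k.castSucc + v k.succ)
  have hElast : E (v (Fin.last m)) = εW • v (Fin.last m) := by
    simp only [E, Module.Basis.constr_basis, Fin.lastCases_last]
  have hEcast : ∀ k : Fin m, E (v k.castSucc) =
      if Even (m + k) then εW • v k.castSucc else εU • v k.castSucc + v k.succ := fun k => by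
    simp only [E, Module.Basis.constr_basis, Fin.lastCases_castSucc]
  have hEW : ∀ k : Fin (m + 1), Even (m + k) → E (v k) = εW • v k := by
    intro k
    induction k using Fin.lastCases with
    | last => exact fun _ => hElast
    | cast k => exact fun hk => by rw [hEcast, if_pos (by simpa using hk)]
  set D : Module.End K V := A - E with hD
  have hDW : ∀ k : Fin m, Even (m + k) → D (v k.castSucc) = -α • v k.castSucc + v k.succ := by
    intro k hk
    rw [hD, LinearMap.sub_apply, hA, hEcast, if_pos hk, if_pos hk, hlW k hk, add_smul]
    abel
  have hDU : ∀ k : Fin m, ¬ Even (m + k) → D (v k.castSucc) = l k • v k.castSucc := by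
    intro k hk
    rw [hD, LinearMap.sub_apply, hA, hEcast, if_neg hk, if_neg hk, add_smul]
    abel
  set a : Module.End K V := algebraMap K _ α with ha
  set b : Module.End K V := algebraMap K _ β with hb
  have haD : Commute a D := Algebra.commutes α D
  have hbD : Commute b D := Algebra.commutes β D
  have hab : Commute a b := Algebra.commutes α b
  have hkill : ∀ x ∈ U, ((D - a) * (D + b)) x = 0 := by
    intro x hx
    induction hx using Submodule.span_induction with
    | zero => rw [map_zero]
    | add x y _ _ hx hy => rw [map_add, hx, hy, add_zero]
    | smul c x _ hx => rw [map_smul, hx, smul_zero]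
    | mem x hx =>
      obtain ⟨k, hk, rfl⟩ := hx
      induction k using Fin.lastCases with
      | last => exact absurd hlastW hk
      | cast k =>
        rw [Fin.val_castSucc] at hk
        rw [Module.End.mul_apply, LinearMap.add_apply, hDU k hk, hb,
          Module.algebraMap_end_apply, ← add_smul, map_smul, LinearMap.sub_apply, hDU k hk, ha,
          Module.algebraMap_end_apply, ← sub_smul, smul_smul]
        rcases hlU k hk with h | h <;> simp [h]
  have hDUU : ∀ x ∈ U, D x ∈ U := by
    intro x hx
    induction hx using Submodule.span_induction with
    | zero => simp
    | add x y _ _ hx hy => rw [map_add]; exact U.add_mem hx hy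
    | smul c x _ hx => rw [map_smul]; exact U.smul_mem _ hx
    | mem x hx =>
      obtain ⟨k, hk, rfl⟩ := hx
      induction k using Fin.lastCases with
      | last => exact absurd hlastW hk
      | cast k =>
        rw [hDU k (by simpa using hk)]
        exact U.smul_mem _ (hvU _ hk)
  have hmapU : ∀ k : Fin m, (D + a) (v k.castSucc) ∈ U := by
    intro k
    by_cases hk : Even (m + k)
    · rw [LinearMap.add_apply, hDW k hk, ha, Module.algebraMap_end_apply, neg_smul,
        neg_add_eq_sub, sub_add_cancel]
      exact hvU _ fun h => (hsucc k).mp h (by simpa using hk)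
    · rw [LinearMap.add_apply, hDU k hk, ha, Module.algebraMap_end_apply, ← add_smul]
      exact U.smul_mem _ (hvU _ (by simpa using hk))
  have hcomm : (D + a) * (D - b) = (D - b) * (D + a) :=
    (((Commute.refl D).sub_right hbD.symm).add_left (haD.sub_right hab)).eq
  have hrange : ∀ x, ((D + a) * (D - b)) x ∈ U := by
    intro x
    induction v.mem_span x using Submodule.span_induction with
    | zero => simp
    | add x y _ _ hx hy => rw [map_add]; exact U.add_mem hx hy
    | smul c x _ hx => rw [map_smul]; exact U.smul_mem _ hx
    | mem x hx =>
      obtain ⟨k, rfl⟩ := hx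
      induction k using Fin.lastCases with
      | cast k =>
        rw [hcomm, Module.End.mul_apply, LinearMap.sub_apply, hb, Module.algebraMap_end_apply]
        exact U.sub_mem (hDUU _ (hmapU k)) (U.smul_mem _ (hmapU k))
      | last =>
        -- The diagonal entry of `D` at the last vector is `β`, so `D - b` leaves only earlier
        -- vectors, which `D + a` sends into `U`.
        have h1 : (D - b) (v (Fin.last m)) =
            ∑ k : Fin m, v.repr (A (v (Fin.last m))) k.castSucc • v k.castSucc := by
          have h2 := v.sum_repr (A (v (Fin.last m)))
          rw [Fin.sum_univ_castSucc, hlast] at h2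
          rw [LinearMap.sub_apply, hD, LinearMap.sub_apply, hElast, hb,
            Module.algebraMap_end_apply]
          conv_lhs => rw [← h2]
          rw [add_smul]
          abel
        rw [Module.End.mul_apply, h1, map_sum]
        exact U.sum_mem fun k _ => by rw [map_smul]; exact U.smul_mem _ (hmapU k)
  refine ⟨E, D, v.ext fun k => ?_, (add_sub_cancel _ _).symm, ?_⟩
  · rw [Module.End.mul_apply]
    by_cases hk : Even (m + k)
    · rw [hEW k hk, map_smul, hEW k hk, smul_smul, hW]
    · induction k using Fin.lastCases with
      | last => exact absurd hlastW hk
      | cast k =>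
        have hk' : ¬ Even (m + (k : ℕ)) := by simpa using hk
        rw [hEcast, if_neg hk', map_add, map_smul, hEcast, if_neg hk', hEW _ ((hsucc k).mpr hk),
          smul_add, smul_smul, hU, add_assoc, ← add_smul, add_comm εU, hWU, one_smul]
  · have hfac : (D ^ 2 - algebraMap K _ (α ^ 2)) * (D ^ 2 - algebraMap K _ (β ^ 2)) =
        ((D - a) * (D + b)) * ((D + a) * (D - b)) := by
      rw [map_pow, map_pow, ← ha, ← hb, haD.symm.sq_sub_sq, hbD.symm.sq_sub_sq,
        (((Commute.refl D).add_right haD.symm).sub_left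
          (haD.add_right (Commute.refl a))).eq.symm, mul_assoc, mul_assoc, ← mul_assoc (D + b),
        ← mul_assoc (D + a),
        (((Commute.refl D).add_right haD.symm).add_left (hbD.add_right hab.symm)).eq, ← mul_assoc]
    rw [hfac]
    ext x
    exact hkill _ (hrange x)

/-! ### Newton bases and cyclic modules -/

open Polynomial in
/-- The Newton polynomials attached to a sequence of nodes. -/
noncomputable def newtonSequence {K : Type*} [Field K] (d : ℕ → K) : Polynomial.Sequence K where
  elems' k := ∏ i ∈ Finset.range k, (X - C (d i))
  degree_eq' k := by rw [degree_prod]; simp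

open Polynomial in
theorem newtonSequence_succ {K : Type*} [Field K] (d : ℕ → K) (k : ℕ) :
    newtonSequence d (k + 1) = newtonSequence d k * (X - C (d k)) :=
  Finset.prod_range_succ _ _

-- Multiplying the `k`-th Newton polynomial by `X - d k` gives the next one. Those of degree below
-- `deg g` stay independent modulo `g`.
open Polynomial in
theorem exists_newton_basis {K : Type*} [Field K] {g : K[X]} (hg : g.Monic) {m : ℕ}
    (hm : g.natDegree = m + 1) (d : ℕ → K) :
    ∃ v : Module.Basis (Fin (m + 1)) K (AdjoinRoot g), ∀ k : Fin m,
      AdjoinRoot.root g * v k.castSucc = d k • v k.castSucc + v k.succ := by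
  have hli : LinearIndependent K
      fun k : Fin (m + 1) => AdjoinRoot.mk g (newtonSequence d (k : ℕ)) := by
    rw [Fintype.linearIndependent_iff]
    intro c hc
    have hdvd : g ∣ ∑ k : Fin (m + 1), c k • newtonSequence d (k : ℕ) := by
      rw [← AdjoinRoot.mk_eq_zero, map_sum, ← hc]
      exact Finset.sum_congr rfl fun k _ => (AdjoinRoot.smul_mk g _ _).symm
    have hdeg : (∑ k : Fin (m + 1), c k • newtonSequence d (k : ℕ)).degree < g.degree := by
      rw [degree_eq_natDegree hg.ne_zero, hm]
      refine (degree_sum_le _ _).trans_lt ((Finset.sup_lt_iff (WithBot.bot_lt_coe _)).mpr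
        fun k _ => (degree_smul_le _ _).trans_lt ?_)
      rw [Sequence.degree_eq]
      exact_mod_cast k.2
    have h0 := eq_zero_of_dvd_of_degree_lt hdvd hdeg
    exact Fintype.linearIndependent_iff.mp
      ((newtonSequence d).linearIndependent.comp _ Fin.val_injective) c h0
  have hfin : Fintype.card (Fin (m + 1)) = Module.finrank K (AdjoinRoot g) := by
    rw [(AdjoinRoot.powerBasis' hg).finrank, AdjoinRoot.powerBasis'_dim, hm, Fintype.card_fin]
  refine ⟨basisOfLinearIndependentOfCardEqFinrank hli hfin, fun k => ?_⟩
  rw [coe_basisOfLinearIndependentOfCardEqFinrank]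
  simp only [Fin.val_castSucc, Fin.val_succ]
  rw [newtonSequence_succ, map_mul, map_sub, AdjoinRoot.mk_X, AdjoinRoot.mk_C, Algebra.smul_def,
    AdjoinRoot.algebraMap_eq]
  ring

open Polynomial in
theorem isIdempotentAddPeriodic_root {K : Type*} [Field K] [Finite K] (h4 : 4 ≤ Nat.card K)
    {N : ℕ} (hN : Even N) (hdvd : Nat.card K - 1 ∣ N) {g : K[X]} (hg : g.Monic) :
    IsIdempotentAddPeriodic N (LinearMap.mulLeft K (AdjoinRoot.root g)) := by
  obtain hm | ⟨m, hm⟩ : g.natDegree = 0 ∨ ∃ m, g.natDegree = m + 1 := by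
    cases g.natDegree <;> simp
  · have h1 : g = 1 := hg.natDegree_eq_zero.mp hm
    have : Subsingleton (AdjoinRoot g) := by
      rw [h1]
      exact Ideal.Quotient.subsingleton_iff.mpr Ideal.span_singleton_one
    exact ⟨0, 0, Subsingleton.elim _ _, Subsingleton.elim _ _, Subsingleton.elim _ _⟩
  obtain ⟨α, β, εW, εU, l, hα, hβ, hne, hW, hU, hWU, hlW, hlU, ht⟩ :=
    exists_diagonal_splitting h4 m (LinearMap.trace K _ (LinearMap.mulLeft K (AdjoinRoot.root g)))
  obtain ⟨v, hv⟩ := exists_newton_basis hg hm fun k => l k + if Even (m + k) then εW else εU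
  obtain ⟨E, D, hE, hED, hD⟩ := exists_splitting_of_basis v
    (LinearMap.mulLeft K (AdjoinRoot.root g)) hW hU hWU hlW hlU hv ht
  obtain ⟨M, rfl⟩ := even_iff_exists_two_mul.mp hN
  have hpow : ∀ x : K, x ≠ 0 → (x ^ 2) ^ M = 1 := by
    intro x hx
    obtain ⟨k, hk⟩ := hdvd
    have := Fintype.ofFinite K
    rw [← pow_mul, hk, pow_mul, Nat.card_eq_fintype_card, FiniteField.pow_card_sub_one_eq_one x hx,
      one_pow]
  exact ⟨E, D, hE, pow_eq_one_of_quartic (hpow α hα) (hpow β hβ) hne hD, hED⟩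

open Polynomial in
theorem isIdempotentAddPeriodic_quotient {K : Type*} [Field K] [Finite K] (h4 : 4 ≤ Nat.card K)
    {N : ℕ} (hN : Even N) (hdvd : Nat.card K - 1 ∣ N) {g : K[X]} (hg : g ≠ 0) :
    IsIdempotentAddPeriodic N
      (LinearMap.mulLeft K (Ideal.Quotient.mk (Ideal.span {g}) (X : K[X]))) := by
  classical
  have hspan : Ideal.span {normalize g} = Ideal.span {g} :=
    Ideal.span_singleton_eq_span_singleton.mpr (normalize_associated g)
  rw [← hspan]
  exact isIdempotentAddPeriodic_root h4 hN hdvd (monic_normalize hg)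

/-! ### Decomposition of an operator into cyclic blocks -/

open DirectSum in
theorem DirectSum.lmap_pow_apply {K ι : Type*} [Semiring K] {M : ι → Type*}
    [∀ i, AddCommMonoid (M i)] [∀ i, Module K (M i)] (f : ∀ i, Module.End K (M i)) (k : ℕ)
    (x : ⨁ i, M i) (i : ι) : ((lmap f : Module.End K (⨁ i, M i)) ^ k) x i = (f i ^ k) (x i) := by
  induction k with
  | zero => rfl
  | succ k ih => rw [pow_succ', pow_succ', Module.End.mul_apply, Module.End.mul_apply, ← ih]; rfl

open DirectSum in
theorem IsIdempotentAddPeriodic.directSum {K ι : Type*} [CommRing K] {M : ι → Type*}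
    [∀ i, AddCommGroup (M i)] [∀ i, Module K (M i)] {f : ∀ i, Module.End K (M i)} {N : ℕ}
    (h : ∀ i, IsIdempotentAddPeriodic N (f i)) :
    IsIdempotentAddPeriodic N (lmap f : Module.End K (⨁ i, M i)) := by
  choose E D hE hD hED using h
  refine ⟨lmap E, lmap D, ?_, ?_, ?_⟩
  · rw [Module.End.mul_eq_comp, ← lmap_comp]
    exact congrArg lmap (funext hE)
  · refine LinearMap.ext fun x => DFinsupp.ext fun i => ?_
    rw [lmap_pow_apply, hD]
    rfl
  · refine LinearMap.ext fun x => DFinsupp.ext fun i => ?_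
    rw [lmap_apply, hED]
    rfl

open Polynomial DirectSum in
/-- Over a finite field `K` with at least four elements, every operator is the sum of an idempotent
and an operator of order dividing `N`, if `N` is even and divisible by `|K| - 1`. -/
theorem isIdempotentAddPeriodic_end {K : Type*} {V : Type*} [Field K] [Finite K] [AddCommGroup V]
    [Module K V] [FiniteDimensional K V] (h4 : 4 ≤ Nat.card K) {N : ℕ} (hN : Even N)
    (hdvd : Nat.card K - 1 ∣ N) (A : Module.End K V) : IsIdempotentAddPeriodic N A := by
  classical
  obtain ⟨ι, _, p, hp, e, ⟨φ⟩⟩ := Module.equiv_directSum_of_isTorsion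
    (Module.AEval.isTorsion_of_finiteDimensional K V A)
  let ψ : V ≃ₗ[K] ⨁ i, K[X] ⧸ K[X] ∙ p i ^ e i :=
    (Module.AEval'.of A).trans (φ.restrictScalars K)
  have hblock := IsIdempotentAddPeriodic.directSum fun i =>
    isIdempotentAddPeriodic_quotient h4 hN hdvd (pow_ne_zero (e i) (hp i).ne_zero)
  have hA : A = ψ.symm.conjAlgEquiv K (lmap fun i =>
      LinearMap.mulLeft K (Ideal.Quotient.mk (Ideal.span {p i ^ e i}) (X : K[X]))) := by
    refine LinearMap.ext fun x => ψ.injective ?_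
    rw [LinearEquiv.conjAlgEquiv_apply, LinearMap.comp_apply, LinearMap.comp_apply]
    simp only [LinearEquiv.coe_coe, LinearEquiv.symm_symm, LinearEquiv.apply_symm_apply]
    have h1 : ψ (A x) = (X : K[X]) • ψ x := by
      change φ (Module.AEval'.of A (A x)) = (X : K[X]) • φ (Module.AEval'.of A x)
      rw [← Module.AEval'.X_smul_of, map_smul]
    rw [h1]
    refine DFinsupp.ext fun i => ?_
    rw [lmap_apply]
    rfl
  rw [hA]
  exact hblock.map (ψ.symm.conjAlgEquiv K).toRingEquiv.toRingHom

/-! ### Matrices and the equivalences -/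

theorem four_le_card {R : Type*} [CommRing R] [IsDomain R] [Finite R]
    (hF2 : ¬ Nonempty (R ≃+* ZMod 2)) (hF3 : ¬ Nonempty (R ≃+* ZMod 3)) : 4 ≤ Nat.card R := by
  have := Fintype.ofFinite R
  have h1 : 1 < Nat.card R := Finite.one_lt_card
  have h2 : Nat.card R ≠ 2 := fun h =>
    hF2 ⟨(ZMod.ringEquivOfPrime R Nat.prime_two (Nat.card_eq_fintype_card.symm.trans h)).symm⟩
  have h3 : Nat.card R ≠ 3 := fun h =>
    hF3 ⟨(ZMod.ringEquivOfPrime R Nat.prime_three (Nat.card_eq_fintype_card.symm.trans h)).symm⟩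
  omega

theorem allIdempotentAddInvertiblePotent_matrix {K : Type*} [Field K] [Finite K]
    (h4 : 4 ≤ Nat.card K) {q : ℕ} (hq : 1 < q) (hodd : Odd q) (hdvd : Nat.card K - 1 ∣ q - 1)
    (n : ℕ) : AllIdempotentAddInvertiblePotent q (Matrix (Fin n) (Fin n) K) := by
  intro A
  have h := (isIdempotentAddPeriodic_end h4 (Nat.Odd.sub_odd hodd odd_one) hdvd
    (Matrix.toLinAlgEquiv' A)).map
      (Matrix.toLinAlgEquiv' (R := K) (n := Fin n)).symm.toRingEquiv.toRingHom
  obtain ⟨e, u, he, hu, hsum⟩ := h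
  refine ⟨e, u, he, IsUnit.of_pow_eq_one hu (by omega), ?_, ?_⟩
  · rw [IsQPotent, ← Nat.sub_add_cancel hq.le, pow_succ, hu, one_mul]
  · rw [← hsum]
    exact ((Matrix.toLinAlgEquiv' (R := K) (n := Fin n)).symm_apply_apply A).symm

theorem AllIdempotentAddInvertiblePotent.allIdempotentAddPotent {S : Type*} [Ring S] {q : ℕ}
    (h : AllIdempotentAddInvertiblePotent q S) : AllIdempotentAddPotent q S := fun a =>
  let ⟨e, u, he, _, hu, hsum⟩ := h a
  ⟨e, u, he, hu, hsum⟩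

theorem mainTheorem9 (q : ℕ) (hq : 1 < q) (hodd : Odd q)
    (R : Type*) [CommRing R] [IsDomain R]
    (hF2 : ¬ Nonempty (R ≃+* ZMod 2)) (hF3 : ¬ Nonempty (R ≃+* ZMod 3)) :
    List.TFAE [
      ∀ n : ℕ, 0 < n → AllIdempotentAddInvertiblePotent q (Matrix (Fin n) (Fin n) R),
      ∃ n : ℕ, 0 < n ∧ AllIdempotentAddInvertiblePotent q (Matrix (Fin n) (Fin n) R),
      ∀ n : ℕ, 0 < n → AllIdempotentAddPotent q (Matrix (Fin n) (Fin n) R),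
      ∃ n : ℕ, 0 < n ∧ AllIdempotentAddPotent q (Matrix (Fin n) (Fin n) R),
      Finite R ∧ IsField R ∧ (Nat.card R - 1) ∣ (q - 1)] ∧
    (IsUnit (2 : R) → ¬ Nonempty (R ≃+* ZMod 3) → ¬ Nonempty (R ≃+* ZMod 5) →
      ¬ Nonempty (R ≃+* GaloisField 3 2) →
      List.TFAE [
        ∀ n : ℕ, 0 < n → AllIdempotentAddInvertiblePotent q (Matrix (Fin n) (Fin n) R),
        ∃ n : ℕ, 0 < n ∧ AllIdempotentAddInvertiblePotent q (Matrix (Fin n) (Fin n) R),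
        ∀ n : ℕ, 0 < n → AllIdempotentAddPotent q (Matrix (Fin n) (Fin n) R),
        ∃ n : ℕ, 0 < n ∧ AllIdempotentAddPotent q (Matrix (Fin n) (Fin n) R),
        Finite R ∧ IsField R ∧ (Nat.card R - 1) ∣ (q - 1),
        ∀ n : ℕ, 0 < n → AllInvolutionAddInvertiblePotent q (Matrix (Fin n) (Fin n) R),
        ∃ n : ℕ, 0 < n ∧ AllInvolutionAddInvertiblePotent q (Matrix (Fin n) (Fin n) R)]) := by
  have h31 : (Finite R ∧ IsField R ∧ (Nat.card R - 1) ∣ (q - 1)) →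
      ∀ n : ℕ, 0 < n → AllIdempotentAddInvertiblePotent q (Matrix (Fin n) (Fin n) R) := by
    rintro ⟨hfin, hfield, hdvd⟩ n -
    let := hfield.toField
    exact allIdempotentAddInvertiblePotent_matrix (four_le_card hF2 hF3) hq hodd hdvd n
  have h23 : (∃ n : ℕ, 0 < n ∧ AllIdempotentAddPotent q (Matrix (Fin n) (Fin n) R)) →
      Finite R ∧ IsField R ∧ (Nat.card R - 1) ∣ (q - 1) := by
    rintro ⟨n, hn, h⟩
    have : NeZero n := ⟨hn.ne'⟩
    exact h.finite_field (R := R) hq hodd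
  refine ⟨?_, fun hu _ _ _ => ?_⟩
  · tfae_have 1 → 2 := fun h => ⟨1, one_pos, h 1 one_pos⟩
    tfae_have 2 → 4 := fun ⟨n, hn, h⟩ => ⟨n, hn, h.allIdempotentAddPotent⟩
    tfae_have 1 → 3 := fun h n hn => (h n hn).allIdempotentAddPotent
    tfae_have 3 → 4 := fun h => ⟨1, one_pos, h 1 one_pos⟩
    tfae_have 4 → 5 := h23
    tfae_have 5 → 1 := h31
    tfae_finish
  · tfae_have 1 → 2 := fun h => ⟨1, one_pos, h 1 one_pos⟩
    tfae_have 2 → 4 := fun ⟨n, hn, h⟩ => ⟨n, hn, h.allIdempotentAddPotent⟩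
    tfae_have 1 → 3 := fun h n hn => (h n hn).allIdempotentAddPotent
    tfae_have 3 → 4 := fun h => ⟨1, one_pos, h 1 one_pos⟩
    tfae_have 4 → 5 := h23
    tfae_have 5 → 1 := h31
    tfae_have 5 → 6 := by
      intro h n hn
      have h1 := h31 h n hn
      obtain ⟨hfin, hfield, hdvd⟩ := h
      let := hfield.toField
      exact h1.allInvolution hq hu.ne_zero hdvd
    tfae_have 6 → 7 := fun h => ⟨1, one_pos, h 1 one_pos⟩
    tfae_have 7 → 5 := by
      rintro ⟨n, hn, h⟩
      have : NeZero n := ⟨hn.ne'⟩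
      exact h.finite_field (R := R) hq
    tfae_finish
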